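/- For integers $p,q,r,a,b,c$ let $K\left(\begin{smallmatrix}p&q&r\\a&b&c\end{smallmatrix}\right)$ be the following link diagram on the sphere $S^2$. A circle separates $S^2$ into an inner and an outer disk. The inner disk contains a Y-shaped tree with edges $A_0,A_1,A_2$ labelled $p,q,r$, and the outer disk a Y-shaped tree with edges $B_0,B_1,B_2$ labelled $a,b,c$; the six edges end on the circle in the cyclic order $A_0,B_0,A_1,B_1,A_2,B_2$. Inside each disk the diagram is the part of the boundary of a thin neighbourhood of the tree that runs along the tree, where the band along an edge with label $n$ is given $|n|$ half twists (crossings); the outer ends of the six bands are arcs into which the circle is divided, and the two parts of the diagram are glued at the six points that separate these arcs. A crossing on an edge with positive label is one whose $A$-smoothing in the Kauffman bracket cuts the band; for a negative label the $A$-smoothing leaves the band uncut. The Jones polynomial of an oriented diagram $D$ with writhe $w$ is $J_D=(-A^3)^{-w}\langle D\rangle$ with $A=t^{-1/4}$, where $\langle D\rangle$ is the Kauffman bracket with value $1$ on the crossingless diagram of the unknot. Say that $K\left(\begin{smallmatrix}p&q&r\\a&b&c\end{smallmatrix}\right)=K\left(\begin{smallmatrix}p'&q'&r'\\a'&b'&c'\end{smallmatrix}\right)$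 *by a $D_3$ symmetry* if the two arrays of labels can be transformed into each other by means of the relations $$K\left(\begin{smallmatrix}p&q&r\\a&b&c\end{smallmatrix}\right)=K\left(\begin{smallmatrix}q&r&p\\b&c&a\end{smallmatrix}\right),\qquad K\left(\begin{smallmatrix}p&q&r\\a&b&c\end{smallmatrix}\right)=K\left(\begin{smallmatrix}p&r&q\\c&b&a\end{smallmatrix}\right).$$ **Lemma.** Let $p,q,r,a,b,c$ be even integers (of any sign, possibly zero), let $\tau\in S_3$ be a transposition, and let $(\tau(a),\tau(b),\tau(c))$ be the triple obtained from $(a,b,c)$ by permuting its three positions by $\tau$. Then, for any choice of orientations of the two diagrams, $$J_{K\left(\begin{smallmatrix}p&q&r\\a&b&c\end{smallmatrix}\right)}=J_{K\left(\begin{smallmatrix}p&q&r\\\tau(a)&\tau(b)&\tau(c)\end{smallmatrix}\right)}$$ if and only if $$K\left(\begin{smallmatrix}p&q&r\\a&b&c\end{smallmatrix}\right)=K\left(\begin{smallmatrix}p&q&r\\\tau(a)&\tau(b)&\tau(c)\end{smallmatrix}\right)$$ by a $D_3$ symmetry. -/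

import Mathlib

open scoped LaurentPolynomial

/-! ### Link diagrams, Kauffman bracket, writhe, Jones polynomial -/

/-- A link diagram given by its planar-diagram code.  The arcs of the diagram carry labels.
A crossing is recorded by the labels of its four ends, listed counterclockwise, such that the ends
numbered `0` and `2` belong to the under-strand and those numbered `1` and `3` to the over-strand.
A join records that two consecutive arcs of the curve are glued, without a crossing.
Every label occurs exactly twice.  The bracket, the writhe and the Jones polynomial only depend
on this code, so that planarity of the code is not needed to define them. -/
structure LinkDiagram where
  Crossing : Type
  Join : Type
  Label : Type
  [fintypeCrossing : Fintype Crossing]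
  [decEqCrossing : DecidableEq Crossing]
  [fintypeJoin : Fintype Join]
  cross : Crossing → Fin 4 → Label
  join : Join → Fin 2 → Label
  twice : ∀ e : Label,
    {h : (Crossing × Fin 4) ⊕ (Join × Fin 2) |
      Sum.elim (fun x => cross x.1 x.2) (fun x => join x.1 x.2) h = e}.ncard = 2

namespace LinkDiagram

attribute [instance] LinkDiagram.fintypeCrossing LinkDiagram.decEqCrossing
  LinkDiagram.fintypeJoin

/-- The ends of arcs at the crossings and at the joins. -/
abbrev End (D : LinkDiagram) : Type := (D.Crossing × Fin 4) ⊕ (D.Join × Fin 2)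

/-- The label of the arc to which an end belongs. -/
def label (D : LinkDiagram) (h : D.End) : D.Label :=
  Sum.elim (fun x => D.cross x.1 x.2) (fun x => D.join x.1 x.2) h

/-- The end to which an end of a crossing is connected in a smoothing.  `true` is the
`A`-smoothing, which merges the two regions swept out by the over-strand when it is rotated
counterclockwise (it connects `0` with `1` and `2` with `3`); `false` is the `A⁻¹`-smoothing
(it connects `0` with `3` and `1` with `2`). -/
def smoothing : Bool → Fin 4 → Fin 4
  | true => ![1, 0, 3, 2]
  | false => ![3, 2, 1, 0]

/-- Two labels are adjacent in the state `s` if they are connected at a join or at a smoothed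
crossing. -/
def StateAdj (D : LinkDiagram) (s : D.Crossing → Bool) (x y : D.Label) : Prop :=
  (∃ j, x = D.join j 0 ∧ y = D.join j 1) ∨
    ∃ c k, x = D.cross c k ∧ y = D.cross c (smoothing (s c) k)

/-- The number of closed curves of the state `s`. -/
noncomputable def loops (D : LinkDiagram) (s : D.Crossing → Bool) : ℕ :=
  Nat.card (Quot (D.StateAdj s))

/-- The Kauffman bracket, a Laurent polynomial in `A = T 1`, by its state sum; the bracket of a
crossingless diagram of the unknot is `1`. -/
noncomputable def bracket (D : LinkDiagram) : ℤ[T;T⁻¹] :=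
  ∑ s : D.Crossing → Bool,
    LaurentPolynomial.T (∑ c, if s c then 1 else -1) *
      (-LaurentPolynomial.T 2 - LaurentPolynomial.T (-2)) ^ (D.loops s - 1)

/-- An orientation of the link: `inward h` tells whether the curve runs through the end `h`
into the crossing or join at that end (and not out of it). -/
structure Orientation (D : LinkDiagram) where
  inward : D.End → Bool
  through_crossing : ∀ c k, inward (Sum.inl (c, k + 2)) = !inward (Sum.inl (c, k))
  through_join : ∀ j, inward (Sum.inr (j, 1)) = !inward (Sum.inr (j, 0))
  along_arc : ∀ h h', h ≠ h' → D.label h = D.label h' → inward h' = !inward h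

/-- The sign of a crossing.  It is positive if the under-strand enters at `0` and the over-strand
at `3`, or the under-strand at `2` and the over-strand at `1`. -/
def sign (D : LinkDiagram) (o : D.Orientation) (c : D.Crossing) : ℤ :=
  if o.inward (Sum.inl (c, 0)) = o.inward (Sum.inl (c, 3)) then 1 else -1

/-- The writhe of an oriented link diagram. -/
def writhe (D : LinkDiagram) (o : D.Orientation) : ℤ := ∑ c, D.sign o c

/-- The Jones polynomial of an oriented link diagram, as a Laurent polynomial in `t ^ (1/4) = T 1`:
it is `(-A ^ 3) ^ (-w) * ⟨D⟩`, where `w` is the writhe, evaluated at `A = t ^ (-1/4)`. -/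
noncomputable def jones (D : LinkDiagram) (o : D.Orientation) : ℤ[T;T⁻¹] :=
  LaurentPolynomial.invert
    (LaurentPolynomial.C (((D.writhe o).negOnePow : ℤˣ) : ℤ) *
      LaurentPolynomial.T (-3 * D.writhe o) * D.bracket)

/-- The other end of the strand that passes a crossing or join. -/
def across (D : LinkDiagram) : D.End → D.End
  | Sum.inl (c, k) => Sum.inl (c, k + 2)
  | Sum.inr (j, k) => Sum.inr (j, k + 1)

theorem across_across (D : LinkDiagram) (h : D.End) : D.across (D.across h) = h := by
  rcases h with ⟨c, k⟩ | ⟨j, k⟩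
  · simp only [across]; fin_cases k <;> rfl
  · simp only [across]; fin_cases k <;> rfl

theorem across_ne (D : LinkDiagram) (h : D.End) : D.across h ≠ h := by
  rcases h with ⟨c, k⟩ | ⟨j, k⟩
  · simp only [across]; fin_cases k <;> simp
  · simp only [across]; fin_cases k <;> simp

theorem exists_partner (D : LinkDiagram) (h : D.End) :
    ∃ h', h' ≠ h ∧ ∀ x, D.label x = D.label h ↔ x = h ∨ x = h' := by
  obtain ⟨x, y, hxy, hs⟩ := Set.ncard_eq_two.1 (D.twice (D.label h))
  have key : ∀ z, D.label z = D.label h ↔ z = x ∨ z = y := fun z => by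
    have := Set.ext_iff.1 hs z
    simpa [label] using this
  rcases (key h).1 rfl with rfl | rfl
  · exact ⟨y, hxy.symm, key⟩
  · exact ⟨x, hxy, fun z => (key z).trans or_comm⟩

/-- Two fixed-point-free involutions admit a common two-colouring. -/
theorem exists_colouring {X : Type} (f g : X → X) (hf : ∀ x, f (f x) = x) (hg : ∀ x, g (g x) = x)
    (hf' : ∀ x, f x ≠ x) (hg' : ∀ x, g x ≠ x) :
    ∃ c : X → Bool, (∀ x, c (f x) = !c x) ∧ ∀ x, c (g x) = !c x := by
  let F : Equiv.Perm X := ⟨f, f, hf, hf⟩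
  let G : Equiv.Perm X := ⟨g, g, hg, hg⟩
  have hFF : F * F = 1 := Equiv.ext hf
  have hGG : G * G = 1 := Equiv.ext hg
  let S : Equiv.Perm X := F * G
  have hGi : G⁻¹ = G := inv_eq_of_mul_eq_one_left hGG
  have hFi : F⁻¹ = F := inv_eq_of_mul_eq_one_left hFF
  have hS : S⁻¹ = G * F := by simp [S, hGi, hFi]
  have hGS : G * S * G⁻¹ = S⁻¹ := by rw [hS, hGi]; simp only [S, mul_assoc, hGG, mul_one]
  have hconj : ∀ k : ℤ, G * S ^ k = S ^ (-k) * G := fun k => by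
    have := conj_zpow (i := k) (a := G) (b := S)
    rw [hGS, inv_zpow', eq_mul_inv_iff_mul_eq] at this
    exact this.symm
  have hno : ∀ (x : X) (k : ℤ), (S ^ k) x ≠ g x := by
    intro x k hk
    rcases Int.even_or_odd' k with ⟨m, rfl | rfl⟩
    · apply hg' ((S ^ m) x)
      have h1 : (G * S ^ m) x = (S ^ (-m) * G) x := by rw [hconj]
      have h2 : (G * S ^ m) x = (S ^ (-m) * S ^ (2 * m)) x := by
        rw [h1]; simp only [Equiv.Perm.mul_apply, hk]; rfl
      rw [← zpow_add] at h2
      rw [show -m + 2 * m = m by ring] at h2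
      exact h2
    · apply hf' ((S ^ (m + 1)) x)
      have h3 : F * S ^ (m + 1) = S ^ (-m) * G := by
        rw [← hconj, zpow_add, zpow_one, ← (Commute.refl S).zpow_right m |>.eq]
        simp only [S, ← mul_assoc, hFF, one_mul]
      have h1 : (F * S ^ (m + 1)) x = (S ^ (-m) * G) x := by rw [h3]
      have h2 : (F * S ^ (m + 1)) x = (S ^ (-m) * S ^ (2 * m + 1)) x := by
        rw [h1]; simp only [Equiv.Perm.mul_apply, hk]; rfl
      rw [← zpow_add] at h2
      rw [show -m + (2 * m + 1) = m + 1 by ring] at h2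
      exact h2
  let r : Setoid X := Equiv.Perm.SameCycle.setoid S
  have hr : ∀ x y, x ≈ y ↔ ∃ k : ℤ, (S ^ k) x = y := fun x y => Iff.rfl
  let q : X → Quotient r := fun x => Quotient.mk r x
  have hlift : ∀ x y, x ≈ y → q (g x) = q (g y) := by
    rintro x y ⟨k, rfl⟩
    refine Quotient.sound ((hr _ _).2 ⟨-k, ?_⟩)
    have : (G * S ^ k) x = (S ^ (-k) * G) x := by rw [hconj]
    exact this.symm
  let φ : Quotient r → Quotient r := Quotient.lift (fun x => q (g x)) hlift
  have hφq : ∀ x, φ (q x) = q (g x) := fun x => rfl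
  have hφφ : ∀ z, φ (φ z) = z := fun z => Quotient.inductionOn z fun x => by
    change q (g (g x)) = q x
    rw [hg]
  have hφ : ∀ z, φ z ≠ z := fun z => Quotient.inductionOn z fun x h => by
    obtain ⟨k, hk⟩ := (hr _ _).1 (Quotient.exact (h : q (g x) = q x).symm)
    exact hno x k hk
  have hfg : ∀ x, q (f x) = q (g x) := fun x => by
    refine (Quotient.sound ((hr _ _).2 ⟨1, ?_⟩)).symm
    simp only [zpow_one, S, Equiv.Perm.mul_apply]
    exact congrArg f (hg x)
  classical
  let _ : LinearOrder (Quotient r) := linearOrderOfSTO (WellOrderingRel (α := Quotient r))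
  have hc : ∀ z, decide (φ z < φ (φ z)) = !decide (z < φ z) := fun z => by
    rw [hφφ]
    rcases lt_or_gt_of_ne (hφ z) with h | h
    · simp [h, h.le]
    · simp [h, h.le]
  refine ⟨fun x => decide (q x < φ (q x)), fun x => ?_, fun x => ?_⟩
  · simp only [hfg, ← hφq]; exact hc _
  · simp only [← hφq]; exact hc _

/-- Every link diagram has an orientation. -/
theorem nonempty_orientation (D : LinkDiagram) : Nonempty D.Orientation := by
  choose p hp hlab using D.exists_partner
  have hpp : ∀ h, p (p h) = h := fun h => by
    have h1 : D.label (p h) = D.label h := (hlab h _).2 (Or.inr rfl)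
    rcases (hlab (p h) h).1 h1.symm with h2 | h2
    · exact absurd h2.symm (hp h)
    · exact h2.symm
  obtain ⟨c, hc, hc'⟩ := exists_colouring D.across p D.across_across hpp D.across_ne hp
  refine ⟨⟨c, fun x k => hc (Sum.inl (x, k)), fun j => hc (Sum.inr (j, 0)), fun h h' hne he => ?_⟩⟩
  rcases (hlab h h').1 he.symm with h1 | h1
  · exact absurd h1.symm hne
  · rw [h1]; exact hc' h

end LinkDiagram

/-! ### The diagrams of girth three -/

/-- The array of edge labels of a pair of Y-shaped trees: `p, q, r` belong to the inner tree and
`a, b, c` to the outer tree. -/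
@[ext] structure TreeLabels where
  p : ℤ
  q : ℤ
  r : ℤ
  a : ℤ
  b : ℤ
  c : ℤ

namespace TreeLabels

/-- The six edges of the two trees. -/
abbrev Edge : Type := Fin 3 ⊕ Fin 3

/-- The number of half twists on an edge, with its sign. -/
def twist (L : TreeLabels) : Edge → ℤ := Sum.elim ![L.p, L.q, L.r] ![L.a, L.b, L.c]

/-- The number of crossings on an edge. -/
def len (L : TreeLabels) (e : Edge) : ℕ := (L.twist e).natAbs

/-- The band along an edge `e` is cut, at its two ends and between consecutive crossings, into
levels `0, …, L.len e`, where level `0` is next to the centre of the tree and level `L.len e` is on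
the circle that separates the two trees.  An arc of the diagram is given by an edge, a level and a
side: `true` is the left and `false` the right side, seen in the direction from the centre of the
tree to the circle. -/
abbrev Arc (L : TreeLabels) : Type := (Σ e : Edge, Fin (L.len e + 1)) × Bool

/-- The crossing number `j` on an edge lies between levels `j` and `j + 1`.  Its ends are listed
counterclockwise.  If the label of the edge is positive, the under-strand starts at the left side
of level `j`, so that the `A`-smoothing cuts the band; if the label is negative, the under-strand
starts at the right side of level `j`, so that the `A`-smoothing leaves the band uncut. -/
def crossArc (L : TreeLabels) (x : Σ e : Edge, Fin (L.len e)) (k : Fin 4) : L.Arc :=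
  ![(⟨x.1, x.2.castSucc⟩, true), (⟨x.1, x.2.castSucc⟩, false),
    (⟨x.1, x.2.succ⟩, false), (⟨x.1, x.2.succ⟩, true)] (if 0 < L.twist x.1 then k else k + 1)

/-- The joins.  The edges `A₀, A₁, A₂` of the inner tree and `B₀, B₁, B₂` of the outer tree end on
the separating circle in the counterclockwise order `A₀, B₀, A₁, B₁, A₂, B₂`.  The joins are, in
this order: around the centre of the inner tree, around the centre of the outer tree, and (two
families) on the separating circle. -/
def joinArc (L : TreeLabels) : Fin 4 × Fin 3 → Fin 2 → L.Arc := fun x =>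
  match x with
  | (0, i) => ![(⟨Sum.inl i, 0⟩, true), (⟨Sum.inl (i + 1), 0⟩, false)]
  | (1, i) => ![(⟨Sum.inr i, 0⟩, false), (⟨Sum.inr (i + 1), 0⟩, true)]
  | (2, i) => ![(⟨Sum.inl i, Fin.last _⟩, true), (⟨Sum.inr i, Fin.last _⟩, true)]
  | (3, i) => ![(⟨Sum.inr i, Fin.last _⟩, false), (⟨Sum.inl (i + 1), Fin.last _⟩, false)]

/-- The arc at an end. -/
def endArc (L : TreeLabels) :
    ((Σ e : Edge, Fin (L.len e)) × Fin 4) ⊕ ((Fin 4 × Fin 3) × Fin 2) → L.Arc :=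
  Sum.elim (fun x => L.crossArc x.1 x.2) (fun x => L.joinArc x.1 x.2)

/-- The join at an arc of level `0`. -/
def lowJoin : Edge → Bool → (Fin 4 × Fin 3) × Fin 2
  | Sum.inl k, true => ((0, k), 0)
  | Sum.inl k, false => ((0, k - 1), 1)
  | Sum.inr k, false => ((1, k), 0)
  | Sum.inr k, true => ((1, k - 1), 1)

/-- The join at an arc of the highest level. -/
def highJoin : Edge → Bool → (Fin 4 × Fin 3) × Fin 2
  | Sum.inl k, true => ((2, k), 0)
  | Sum.inl k, false => ((3, k - 1), 1)
  | Sum.inr k, false => ((3, k), 0)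
  | Sum.inr k, true => ((2, k), 1)

/-- The end of an arc that points to the centre of the tree. -/
def lowEnd (L : TreeLabels) (x : L.Arc) :
    ((Σ e : Edge, Fin (L.len e)) × Fin 4) ⊕ ((Fin 4 × Fin 3) × Fin 2) :=
  if h : x.1.2 = 0 then Sum.inr (lowJoin x.1.1 x.2)
  else Sum.inl (⟨x.1.1, x.1.2.pred h⟩,
    (if x.2 then 3 else 2) - (if 0 < L.twist x.1.1 then 0 else 1))

/-- The end of an arc that points to the separating circle. -/
def highEnd (L : TreeLabels) (x : L.Arc) :
    ((Σ e : Edge, Fin (L.len e)) × Fin 4) ⊕ ((Fin 4 × Fin 3) × Fin 2) :=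
  if h : x.1.2 = Fin.last _ then Sum.inr (highJoin x.1.1 x.2)
  else Sum.inl (⟨x.1.1, x.1.2.castPred h⟩,
    (if x.2 then 0 else 1) - (if 0 < L.twist x.1.1 then 0 else 1))

theorem endArc_lowEnd (L : TreeLabels) (x : L.Arc) : L.endArc (L.lowEnd x) = x := by
  obtain ⟨⟨e, i⟩, s⟩ := x
  by_cases h : i = 0
  · subst h
    rcases e with k | k <;> cases s <;> fin_cases k <;> rfl
  · simp only [lowEnd, h, dite_false, endArc, Sum.elim_inl, crossArc]
    by_cases ht : 0 < L.twist e <;> cases s <;> simp [ht]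

theorem endArc_highEnd (L : TreeLabels) (x : L.Arc) : L.endArc (L.highEnd x) = x := by
  obtain ⟨⟨e, i⟩, s⟩ := x
  by_cases h : i = Fin.last _
  · subst h
    simp only [highEnd, dite_true]
    rcases e with k | k <;> cases s <;> fin_cases k <;> rfl
  · simp only [highEnd, h, dite_false, endArc, Sum.elim_inl, crossArc]
    by_cases ht : 0 < L.twist e <;> cases s <;> simp [ht]

theorem eq_lowEnd_or_highEnd (L : TreeLabels)
    (h : ((Σ e : Edge, Fin (L.len e)) × Fin 4) ⊕ ((Fin 4 × Fin 3) × Fin 2)) :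
    h = L.lowEnd (L.endArc h) ∨ h = L.highEnd (L.endArc h) := by
  rcases h with ⟨⟨e, j⟩, k⟩ | ⟨⟨m, i⟩, k⟩
  · have h1 : ∀ s, L.lowEnd (⟨e, j.succ⟩, s) = Sum.inl (⟨e, j⟩,
        (if s then 3 else 2) - (if 0 < L.twist e then 0 else 1)) := fun s => by
      simp [lowEnd]
    have h2 : ∀ s, L.highEnd (⟨e, j.castSucc⟩, s) = Sum.inl (⟨e, j⟩,
        (if s then 0 else 1) - (if 0 < L.twist e then 0 else 1)) := fun s => by
      simp [highEnd, Fin.castSucc_ne_last]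
    by_cases ht : 0 < L.twist e <;> simp only [ht, if_true, if_false] at h1 h2 <;>
      simp only [endArc, Sum.elim_inl, crossArc, ht, if_true, if_false] <;> fin_cases k
    · exact Or.inr (h2 true).symm
    · exact Or.inr (h2 false).symm
    · exact Or.inl (h1 false).symm
    · exact Or.inl (h1 true).symm
    · exact Or.inr (h2 false).symm
    · exact Or.inl (h1 false).symm
    · exact Or.inl (h1 true).symm
    · exact Or.inr (h2 true).symm
  · have h1 : ∀ e s, L.lowEnd (⟨e, 0⟩, s) = Sum.inr (lowJoin e s) := fun e s => by simp [lowEnd]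
    have h2 : ∀ e s, L.highEnd (⟨e, Fin.last _⟩, s) = Sum.inr (highJoin e s) := fun e s => by
      simp [highEnd]
    fin_cases m <;> fin_cases k <;> simp [endArc, joinArc, h1, h2, lowJoin, highJoin]

theorem lowEnd_ne_highEnd (L : TreeLabels) (x : L.Arc) : L.lowEnd x ≠ L.highEnd x := by
  obtain ⟨⟨e, i⟩, s⟩ := x
  by_cases h : i = 0 <;> by_cases h' : i = Fin.last _
  · simp only [lowEnd, highEnd, h, dite_true]
    rw [dif_pos (h.symm.trans h')]
    rcases e with k | k <;> cases s <;> simp [lowJoin, highJoin]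
  · simp only [lowEnd, highEnd, h, dite_true]
    rw [dif_neg (fun h2 => h' (h.trans h2))]
    simp
  · simp only [highEnd, h', dite_true]
    simp only [lowEnd]
    rw [dif_neg (fun h2 => h (h'.trans h2))]
    simp
  · simp only [lowEnd, highEnd, h, h', dite_false, ne_eq, Sum.inl.injEq, Prod.mk.injEq, not_and]
    intro _
    cases s <;> simp

/-- The link diagram of girth three with the given edge labels. -/
def diagram (L : TreeLabels) : LinkDiagram where
  Crossing := Σ e : Edge, Fin (L.len e)
  Join := Fin 4 × Fin 3
  Label := L.Arc
  cross := L.crossArc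
  join := L.joinArc
  twice := fun x => by
    refine Set.ncard_eq_two.2 ⟨L.lowEnd x, L.highEnd x, L.lowEnd_ne_highEnd x, ?_⟩
    ext h
    simp only [Set.mem_ofPred_eq, Set.mem_insert_iff, Set.mem_singleton_iff]
    constructor
    · rintro rfl
      exact L.eq_lowEnd_or_highEnd h
    · rintro (rfl | rfl)
      · exact L.endArc_lowEnd x
      · exact L.endArc_highEnd x

/-- The two generating symmetries: the rotation by a third of a full turn, and the reflection. -/
inductive D3Step : TreeLabels → TreeLabels → Prop
  | rotation (p q r a b c : ℤ) : D3Step ⟨p, q, r, a, b, c⟩ ⟨q, r, p, b, c, a⟩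
  | reflection (p q r a b c : ℤ) : D3Step ⟨p, q, r, a, b, c⟩ ⟨p, r, q, c, b, a⟩

/-- Two diagrams are equal by a `D₃` symmetry if they are interchangeable by the rotation and
reflection relations, that is, related by the equivalence relation which these generate. -/
def EqByD3 : TreeLabels → TreeLabels → Prop := Relation.EqvGen D3Step

end TreeLabels

/-!
In a state, a band with `n ≥ 1` cuts contributes `n - 1` closed curves of its own and is otherwise
just a cut band, so the bracket is a state sum over the `2 ^ 6` choices of cut bands in which every
band carries one weight for being cut and one for being left uncut.  The curves inside a disk form
a noncrossing matching of the six points on the circle.  Hence the number of closed curves depends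
only on the numbers of cut inner and outer bands, except that it is `3` instead of `1` when the
only cut bands are some `Aᵢ` and its opposite `Bᵢ₊₁`.

With `δ` the value of a closed curve, the bracket is therefore the sum of a term that is symmetric
in the outer labels and of `(δ ^ 2 - 1) * ∑ i, uᵢ * vᵢ₊₁`, where `uᵢ` and `vⱼ` are the weights of
the states of one disk that cut only `Aᵢ` or only `Bⱼ`.  Under the transposition of `vⱼ` and `vⱼ₊₁`
this changes by `(uⱼ - uⱼ₊₂) * (vⱼ₊₁ - vⱼ)` up to sign, and equal weights mean equal labels.  The
relations of `D₃` preserve the same bilinear form in the labels themselves, so that a `D₃` symmetry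
also requires one of these two equalities of labels, and each of them provides one.

When all labels are even, the two sides of each band are oriented oppositely, so that the writhe
is the sum of the labels for every orientation.
-/

/-! ### Counting the classes of a finite relation -/

/-- A table on the vertices of a graph with edges `E` that takes equal values exactly at the
vertices of one component.  It is built by merging two entries for each edge, so that the kernel
can evaluate it. -/
def classTable {n : ℕ} : List (Fin n × Fin n) → List.Vector (Fin n) n
  | [] => List.Vector.ofFn id
  | (u, v) :: E => (classTable E).map fun x =>
      if x = (classTable E).get u then (classTable E).get v else x

theorem quotMk_cons_eq_iff {α β : Type*} [DecidableEq α] {E : List (β × β)} {f : β → α}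
    (hf : ∀ x y, Quot.mk (fun a b => (a, b) ∈ E) x = Quot.mk _ y ↔ f x = f y) (u v x y : β) :
    Quot.mk (fun a b => (a, b) ∈ (u, v) :: E) x = Quot.mk _ y ↔
      (if f x = f u then f v else f x) = if f y = f u then f v else f y := by
  constructor
  · refine fun h => congrArg (Quot.lift (fun z => if f z = f u then f v else f z) ?_) h
    rintro a b hab
    rcases List.mem_cons.1 hab with huv | hE
    · obtain ⟨rfl, rfl⟩ := Prod.mk.inj huv
      simp only [if_true, ite_self]
    · simp only [(hf a b).1 (Quot.sound hE)]
  · have of_eq {a b : β} (h : f a = f b) :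
        Quot.mk (fun a b => (a, b) ∈ (u, v) :: E) a = Quot.mk _ b :=
      congrArg (Quot.map id fun _ _ => List.mem_cons_of_mem _) ((hf a b).2 h)
    have rep (z : β) : Quot.mk (fun a b => (a, b) ∈ (u, v) :: E) z =
        Quot.mk _ (if f z = f u then v else z) := by
      split_ifs with hz
      · exact (of_eq hz).trans (Quot.sound List.mem_cons_self)
      · rfl
    intro h
    rw [rep x, rep y]
    exact of_eq (by simpa only [apply_ite f] using h)

theorem quotMk_eq_iff_classTable {n : ℕ} (E : List (Fin n × Fin n)) (x y : Fin n) :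
    Quot.mk (fun a b => (a, b) ∈ E) x = Quot.mk _ y ↔
      (classTable E).get x = (classTable E).get y := by
  induction E generalizing x y with
  | nil =>
    simp only [classTable, List.Vector.get_ofFn, id]
    exact ⟨congrArg (Quot.lift id fun a b h => absurd h List.not_mem_nil), congrArg _⟩
  | cons p E ih =>
    simp only [quotMk_cons_eq_iff ih, classTable, List.Vector.get_map]

theorem card_quot_eq_card_image_classTable {n : ℕ} (E : List (Fin n × Fin n)) :
    Nat.card (Quot fun a b => (a, b) ∈ E) = (Finset.univ.image (classTable E).get).card := by
  have hinj : Function.Injective (Quot.lift (classTable E).get fun x y h =>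
      (quotMk_eq_iff_classTable E x y).1 (Quot.sound h)) := by
    rintro ⟨x⟩ ⟨y⟩ h
    exact (quotMk_eq_iff_classTable E x y).2 h
  rw [← Nat.card_range_of_injective hinj, Set.range_quot_lift, ← Set.image_univ,
    ← Finset.coe_univ, ← Finset.coe_image, Nat.card_coe_set_eq, Set.ncard_coe_finset]

/-! ### Cuts of a band -/

/-- The number of `j` with `b j = true`: the number of cuts of a band if `b` tells which of its
crossings cut it, or the number of cut bands if `b` tells which bands are cut. -/
def numCuts {ι : Type*} [Fintype ι] (b : ι → Bool) : ℕ := ∑ j, (b j).toNat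

/-- The number of cuts of a band below the level `i`. -/
def cutsBefore {n : ℕ} (b : Fin n → Bool) : Fin (n + 1) → ℕ :=
  Fin.partialSum fun j => (b j).toNat

theorem cutsBefore_zero {n : ℕ} (b : Fin n → Bool) : cutsBefore b 0 = 0 :=
  Fin.partialSum_zero _

theorem cutsBefore_succ {n : ℕ} (b : Fin n → Bool) (j : Fin n) :
    cutsBefore b j.succ = cutsBefore b j.castSucc + (b j).toNat :=
  Fin.partialSum_succ _ j

theorem cutsBefore_last {n : ℕ} (b : Fin n → Bool) : cutsBefore b (Fin.last n) = numCuts b := by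
  simp [cutsBefore, numCuts, Fin.partialSum, List.take_of_length_le, List.sum_ofFn]

theorem cutsBefore_mono {n : ℕ} (b : Fin n → Bool) : Monotone (cutsBefore b) :=
  Fin.monotone_iff_le_succ.2 fun j => (cutsBefore_succ b j).symm ▸ Nat.le_add_right _ _

theorem cutsBefore_le {n : ℕ} (b : Fin n → Bool) (i : Fin (n + 1)) : cutsBefore b i ≤ numCuts b :=
  cutsBefore_last b ▸ cutsBefore_mono b (Fin.le_last i)

theorem numCuts_pos {ι : Type*} [Fintype ι] {b : ι → Bool} {j : ι} (hj : b j = true) :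
    0 < numCuts b :=
  Finset.sum_pos' (fun _ _ => Nat.zero_le _) ⟨j, Finset.mem_univ j, by simp [hj]⟩

theorem exists_cut {n : ℕ} (b : Fin n → Bool) {m : ℕ} (h : m < numCuts b) :
    ∃ j, b j = true ∧ cutsBefore b j.castSucc = m := by
  suffices ∀ i, m < cutsBefore b i → ∃ j, b j = true ∧ cutsBefore b j.castSucc = m from
    this (Fin.last n) (cutsBefore_last b ▸ h)
  intro i hi
  induction i using Fin.induction with
  | zero => simp [cutsBefore_zero] at hi
  | succ j ih =>
    rcases lt_or_ge m (cutsBefore b j.castSucc) with hm | hm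
    · exact ih hm
    · rw [cutsBefore_succ] at hi
      cases hj : b j <;> rw [hj] at hi
      · exact absurd hi hm.not_gt
      · exact ⟨j, hj, le_antisymm hm (Nat.le_of_lt_succ hi)⟩

theorem eq_of_cutsBefore_eq {α : Type*} {n : ℕ} {b : Fin n → Bool} {p : Fin (n + 1) → α}
    (hp : ∀ j, b j = false → p j.castSucc = p j.succ) {i i' : Fin (n + 1)}
    (h : cutsBefore b i = cutsBefore b i') : p i = p i' := by
  wlog hi : i ≤ i' generalizing i i'
  · exact (this h.symm (le_of_not_ge hi)).symm
  induction i' using Fin.induction with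
  | zero => rw [Fin.le_zero_iff.1 hi]
  | succ j ih =>
    rcases hi.eq_or_lt with rfl | hi
    · rfl
    have hij : i ≤ j.castSucc := Fin.le_castSucc_iff.2 hi
    have hle := cutsBefore_mono b hij
    rw [cutsBefore_succ] at h
    cases hj : b j <;> rw [hj] at h
    · exact (ih h hij).trans (hp j hj)
    · exact absurd (h ▸ hle) (Nat.lt_succ_self _).not_ge

namespace TreeLabels

/-! ### The writhe -/

/-- The ends of arcs in `L.diagram`, spelt out so that rewriting need not unfold `diagram`. -/
abbrev End (L : TreeLabels) : Type :=
  ((Σ e : Edge, Fin (L.len e)) × Fin 4) ⊕ ((Fin 4 × Fin 3) × Fin 2)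

theorem lowEnd_zero (L : TreeLabels) (e : Edge) (t : Bool) :
    L.lowEnd (⟨e, 0⟩, t) = Sum.inr (lowJoin e t) := by
  simp [lowEnd]

theorem highEnd_last (L : TreeLabels) (e : Edge) (t : Bool) :
    L.highEnd (⟨e, Fin.last _⟩, t) = Sum.inr (highJoin e t) := by
  simp [highEnd]

theorem lowEnd_succ (L : TreeLabels) (e : Edge) (j : Fin (L.len e)) (t : Bool) :
    L.lowEnd (⟨e, j.succ⟩, t) =
      Sum.inl (⟨e, j⟩, (if t then 3 else 2) - (if 0 < L.twist e then 0 else 1)) := by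
  simp [lowEnd]

theorem highEnd_castSucc (L : TreeLabels) (e : Edge) (j : Fin (L.len e)) (t : Bool) :
    L.highEnd (⟨e, j.castSucc⟩, t) =
      Sum.inl (⟨e, j⟩, (if t then 0 else 1) - (if 0 < L.twist e then 0 else 1)) := by
  simp [highEnd, Fin.castSucc_ne_last]

section Writhe

variable {L : TreeLabels} (o : L.diagram.Orientation)

/-- The orientation at an end of an arc. -/
def inward (h : L.End) : Bool := o.inward h

/-- Whether an arc is oriented from the centre of its tree towards the separating circle. -/
def outward (x : L.Arc) : Bool := inward o (L.highEnd x)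

theorem inward_highEnd (x : L.Arc) : inward o (L.highEnd x) = outward o x := rfl

theorem inward_lowEnd (x : L.Arc) : inward o (L.lowEnd x) = !outward o x :=
  o.along_arc (L.highEnd x) (L.lowEnd x) (L.lowEnd_ne_highEnd x).symm
    ((L.endArc_highEnd x).trans (L.endArc_lowEnd x).symm)

theorem inward_crossing (c : Σ e : Edge, Fin (L.len e)) (k : Fin 4) :
    inward o (Sum.inl (c, k + 2)) = !inward o (Sum.inl (c, k)) :=
  o.through_crossing c k

theorem inward_join (m : Fin 4 × Fin 3) : inward o (Sum.inr (m, 0)) = !inward o (Sum.inr (m, 1)) :=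
  (Bool.not_not _).symm.trans (congrArg not (o.through_join m).symm)

theorem outward_lowJoin {e e' : Edge} {t t' : Bool} {m : Fin 4 × Fin 3}
    (h : lowJoin e t = (m, 0)) (h' : lowJoin e' t' = (m, 1)) :
    outward o (⟨e, 0⟩, t) = !outward o (⟨e', 0⟩, t') := by
  rw [← Bool.not_inj_iff, ← inward_lowEnd, ← inward_lowEnd, lowEnd_zero, lowEnd_zero, h, h',
    inward_join]

theorem outward_highJoin {e e' : Edge} {t t' : Bool} {m : Fin 4 × Fin 3}
    (h : highJoin e t = (m, 0)) (h' : highJoin e' t' = (m, 1)) :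
    outward o (⟨e, Fin.last _⟩, t) = !outward o (⟨e', Fin.last _⟩, t') := by
  rw [← inward_highEnd, ← inward_highEnd, highEnd_last, highEnd_last, h, h', inward_join]

theorem outward_succ (e : Edge) (j : Fin (L.len e)) (t : Bool) :
    outward o (⟨e, j.succ⟩, t) = outward o (⟨e, j.castSucc⟩, !t) := by
  rw [← Bool.not_inj_iff, ← inward_lowEnd, ← inward_highEnd, highEnd_castSucc, lowEnd_succ,
    ← inward_crossing]
  congr 3
  by_cases ht : 0 < L.twist e <;> cases t <;> simp only [ht] <;> rfl

theorem outward_level (e : Edge) (i : Fin (L.len e + 1)) (t : Bool) :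
    outward o (⟨e, i⟩, t) = outward o (⟨e, 0⟩, t ^^ decide (Odd (i : ℕ))) := by
  induction i using Fin.induction generalizing t with
  | zero => simp
  | succ j ih =>
    rw [outward_succ, ih]
    by_cases h : Odd (j : ℕ) <;> simp [h, Nat.odd_add_one]

theorem outward_last (heven : ∀ e, Even (L.twist e)) (e : Edge) (t : Bool) :
    outward o (⟨e, Fin.last _⟩, t) = outward o (⟨e, 0⟩, t) := by
  rw [outward_level]
  simp [len, Int.not_odd_iff_even.2 (heven e)]

/-- Following the curve from one side of an even band around the neighbouring band leads to the
other side of the band. -/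
theorem outward_zero_true (heven : ∀ e, Even (L.twist e)) (e : Edge) :
    outward o (⟨e, 0⟩, true) = !outward o (⟨e, 0⟩, false) := by
  have circle {e e' : Edge} {t t' : Bool} {m : Fin 4 × Fin 3}
      (h : highJoin e t = (m, 0)) (h' : highJoin e' t' = (m, 1)) :
      outward o (⟨e, 0⟩, t) = !outward o (⟨e', 0⟩, t') := by
    rw [← outward_last o heven, ← outward_last o heven, outward_highJoin o h h']
  rcases e with i | i
  · calc outward o (⟨Sum.inl i, 0⟩, true)
      _ = !outward o (⟨Sum.inr i, 0⟩, true) := circle (m := (2, i)) rfl rfl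
      _ = outward o (⟨Sum.inr (i - 1), 0⟩, false) :=
        (outward_lowJoin o (m := (1, i - 1)) rfl rfl).symm
      _ = !outward o (⟨Sum.inl i, 0⟩, false) := circle (m := (3, i - 1)) rfl rfl
  · have center : outward o (⟨Sum.inl i, 0⟩, true) = !outward o (⟨Sum.inl (i + 1), 0⟩, false) :=
      outward_lowJoin o (m := (0, i)) rfl (by simp [lowJoin])
    have left : outward o (⟨Sum.inl i, 0⟩, true) = !outward o (⟨Sum.inr i, 0⟩, true) :=
      circle (m := (2, i)) rfl rfl
    have right : outward o (⟨Sum.inr i, 0⟩, false) = !outward o (⟨Sum.inl (i + 1), 0⟩, false) :=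
      circle (m := (3, i)) rfl (by simp [highJoin])
    rw [right, ← center, left, Bool.not_not]

theorem outward_true (heven : ∀ e, Even (L.twist e)) (e : Edge)
    (i : Fin (L.len e + 1)) :
    outward o (⟨e, i⟩, true) = !outward o (⟨e, i⟩, false) := by
  rw [outward_level, outward_level o _ _ false]
  by_cases h : Odd (i : ℕ) <;> simp [h, outward_zero_true o heven e]

theorem sign_eq_sign_twist (heven : ∀ e, Even (L.twist e)) (e : Edge)
    (j : Fin (L.len e)) :
    L.diagram.sign o ⟨e, j⟩ = (L.twist e).sign := by
  have sign_eq : L.diagram.sign o ⟨e, j⟩ =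
    if inward o (Sum.inl (⟨e, j⟩, 0)) = inward o (Sum.inl (⟨e, j⟩, 3)) then 1 else -1 := rfl
  have sides := outward_true o heven e j.castSucc
  rw [sign_eq]
  rcases lt_trichotomy (L.twist e) 0 with ht | ht | ht
  · rw [← inward_highEnd, ← inward_highEnd, highEnd_castSucc, highEnd_castSucc,
      if_neg ht.not_gt] at sides
    rw [Int.sign_eq_neg_one_of_neg ht]
    exact if_neg fun h => Bool.not_ne_self _ (h.trans sides).symm
  · exact absurd j.2 (by simp [len, ht])
  · have low := inward_lowEnd o (⟨e, j.succ⟩, true)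
    rw [outward_succ, Bool.not_true, ← sides, ← inward_highEnd, lowEnd_succ, highEnd_castSucc,
      if_pos ht] at low
    rw [Int.sign_eq_one_of_pos ht]
    exact if_pos low.symm

theorem writhe_eq_sum_twist (heven : ∀ e, Even (L.twist e)) :
    L.diagram.writhe o = ∑ e, L.twist e := by
  calc L.diagram.writhe o
    _ = ∑ c : Σ e : Edge, Fin (L.len e), (L.twist c.1).sign :=
      Finset.sum_congr rfl fun c _ => sign_eq_sign_twist o heven c.1 c.2
    _ = ∑ e, ∑ _j : Fin (L.len e), (L.twist e).sign := Fintype.sum_sigma _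
    _ = ∑ e, L.twist e := Finset.sum_congr rfl fun e _ => by
      rw [Finset.sum_const, Finset.card_univ, Fintype.card_fin, nsmul_eq_mul, len, mul_comm,
        Int.sign_mul_natAbs]

end Writhe

/-! ### The closed curves of a state -/

/-- The strands by which a band is replaced when it is cut or left uncut, as pairs of joins. -/
def strand (S : Edge → Bool) (e : Edge) (t : Bool) : (Fin 4 × Fin 3) × (Fin 4 × Fin 3) :=
  match S e, t with
  | true, true => ((lowJoin e true).1, (lowJoin e false).1)
  | true, false => ((highJoin e true).1, (highJoin e false).1)
  | false, t => ((lowJoin e t).1, (highJoin e t).1)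

/-- Two joins are adjacent if a strand connects them when exactly the bands in `S` are cut. -/
def BandAdj (S : Edge → Bool) (x y : Fin 4 × Fin 3) : Prop := ∃ e t, strand S e t = (x, y)

/-- A state of `L.diagram` told by which crossings cut their band. -/
abbrev CutPattern (L : TreeLabels) : Type := ∀ e : Edge, Fin (L.len e) → Bool

/-- The four arcs at a crossing, listed counterclockwise from the left side of the lower level. -/
def corner {L : TreeLabels} (e : Edge) (j : Fin (L.len e)) : Fin 4 → L.Arc :=
  ![(⟨e, j.castSucc⟩, true), (⟨e, j.castSucc⟩, false), (⟨e, j.succ⟩, false), (⟨e, j.succ⟩, true)]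

/-- The adjacency of arcs in a state: in the numbering of `corner`, the smoothing `true` is the
one that cuts the band. -/
def ArcAdj {L : TreeLabels} (c : L.CutPattern) (x y : L.Arc) : Prop :=
  (∃ m, x = L.joinArc m 0 ∧ y = L.joinArc m 1) ∨
    ∃ e j k, x = corner e j k ∧ y = corner e j (LinkDiagram.smoothing (c e j) k)

/-- The passage from the smoothings in a state to the crossings that cut their band. -/
def cutPattern (L : TreeLabels) : (L.diagram.Crossing → Bool) ≃ L.CutPattern :=
  (Equiv.piCurry fun (_ : Edge) _ => Bool).trans <|
    Equiv.piCongrRight fun e => Equiv.piCongrRight fun _ =>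
      Function.Involutive.toPerm (· == decide (0 < L.twist e)) fun b => by
        cases b <;> cases decide (0 < L.twist e) <;> rfl

theorem exists_crossArc_iff {L : TreeLabels} {e : Edge} {j : Fin (L.len e)} {b : Bool}
    {x y : L.Arc} :
    (∃ k, x = L.crossArc ⟨e, j⟩ k ∧ y = L.crossArc ⟨e, j⟩ (LinkDiagram.smoothing b k)) ↔
      ∃ k, x = corner e j k ∧
        y = corner e j (LinkDiagram.smoothing (b == decide (0 < L.twist e)) k) := by
  have crossArc_eq (k : Fin 4) :
    L.crossArc ⟨e, j⟩ k = corner e j (if 0 < L.twist e then k else k + 1) := rfl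
  have smoothing_add_one (b : Bool) (k : Fin 4) :
      LinkDiagram.smoothing b k + 1 = LinkDiagram.smoothing (!b) (k + 1) := by
    revert b k; decide
  by_cases ht : 0 < L.twist e
  · simp only [crossArc_eq, ht, if_true, decide_true, beq_true]
  · simp only [crossArc_eq, ht, if_false, decide_false, beq_false, smoothing_add_one]
    exact ((Equiv.addRight (1 : Fin 4)).surjective.exists (p := fun k =>
      x = corner e j k ∧ y = corner e j (LinkDiagram.smoothing (!b) k))).symm

theorem loops_eq_card_quot_arcAdj {L : TreeLabels} (s : L.diagram.Crossing → Bool) :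
    L.diagram.loops s = Nat.card (Quot (ArcAdj (L.cutPattern s))) := by
  have h : L.diagram.StateAdj s = ArcAdj (L.cutPattern s) := by
    ext x y
    refine or_congr_right (Sigma.exists.trans ?_)
    exact exists_congr fun e => exists_congr fun j => exists_crossArc_iff
  rw [LinkDiagram.loops, h]
  rfl

section

variable {L : TreeLabels} {c : L.CutPattern}

theorem quotMk_below_cut {e : Edge} {j : Fin (L.len e)} (h : c e j = true) :
    Quot.mk (ArcAdj c) (⟨e, j.castSucc⟩, true) = Quot.mk _ (⟨e, j.castSucc⟩, false) :=
  Quot.sound (Or.inr ⟨e, j, 0, rfl, by rw [h]; rfl⟩)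

theorem quotMk_above_cut {e : Edge} {j : Fin (L.len e)} (h : c e j = true) :
    Quot.mk (ArcAdj c) (⟨e, j.succ⟩, true) = Quot.mk _ (⟨e, j.succ⟩, false) :=
  Quot.sound (Or.inr ⟨e, j, 3, rfl, by rw [h]; rfl⟩)

theorem quotMk_past_uncut {e : Edge} {j : Fin (L.len e)} (h : c e j = false) (t : Bool) :
    Quot.mk (ArcAdj c) (⟨e, j.castSucc⟩, t) = Quot.mk _ (⟨e, j.succ⟩, t) := by
  cases t
  · exact Quot.sound (Or.inr ⟨e, j, 1, rfl, by rw [h]; rfl⟩)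
  · exact Quot.sound (Or.inr ⟨e, j, 0, rfl, by rw [h]; rfl⟩)

theorem quotMk_level {e : Edge} {i i' : Fin (L.len e + 1)}
    (h : cutsBefore (c e) i = cutsBefore (c e) i') (t : Bool) :
    Quot.mk (ArcAdj c) (⟨e, i⟩, t) = Quot.mk _ (⟨e, i'⟩, t) :=
  eq_of_cutsBefore_eq (p := fun i => Quot.mk (ArcAdj c) (⟨e, i⟩, t))
    (fun _ hj => quotMk_past_uncut hj t) h

theorem quotMk_sides {e : Edge} (h : 0 < numCuts (c e)) (i : Fin (L.len e + 1)) :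
    Quot.mk (ArcAdj c) (⟨e, i⟩, true) = Quot.mk _ (⟨e, i⟩, false) := by
  rcases (cutsBefore_le (c e) i).lt_or_eq with hi | hi
  · obtain ⟨j, hj, hij⟩ := exists_cut _ hi
    rw [quotMk_level hij.symm true, quotMk_level hij.symm false, quotMk_below_cut hj]
  · obtain ⟨j, hj, hij⟩ := exists_cut (c e) (Nat.sub_lt h one_pos)
    have hij' : cutsBefore (c e) i = cutsBefore (c e) j.succ := by
      rw [hi, cutsBefore_succ, hj, hij]
      exact (Nat.sub_add_cancel h).symm
    rw [quotMk_level hij' true, quotMk_level hij' false, quotMk_above_cut hj]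

theorem quotMk_joinArc (m : Fin 4 × Fin 3) (k : Fin 2) :
    Quot.mk (ArcAdj c) (L.joinArc m k) = Quot.mk _ (L.joinArc m 0) := by
  fin_cases k
  · rfl
  · exact Eq.symm (Quot.sound (r := ArcAdj c) (Or.inl ⟨m, rfl, rfl⟩))

theorem quotMk_lowJoin (e : Edge) (t : Bool) :
    Quot.mk (ArcAdj c) (L.joinArc (lowJoin e t).1 0) = Quot.mk _ (⟨e, 0⟩, t) := by
  have h := L.endArc_lowEnd (⟨e, 0⟩, t)
  rw [lowEnd_zero] at h
  rw [← quotMk_joinArc _ (lowJoin e t).2]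
  exact congrArg _ h

theorem quotMk_highJoin (e : Edge) (t : Bool) :
    Quot.mk (ArcAdj c) (L.joinArc (highJoin e t).1 0) = Quot.mk _ (⟨e, Fin.last _⟩, t) := by
  have h := L.endArc_highEnd (⟨e, Fin.last _⟩, t)
  rw [highEnd_last] at h
  rw [← quotMk_joinArc _ (highJoin e t).2]
  exact congrArg _ h

end

/-- The bands that are cut at least once. -/
def cutBands {L : TreeLabels} (c : L.CutPattern) (e : Edge) : Bool := decide (0 < numCuts (c e))

/-- The closed curves of a state: those that run through joins, and for each band with `n` cuts
the `n - 1` curves between consecutive cuts. -/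
abbrev Curve {L : TreeLabels} (c : L.CutPattern) : Type :=
  Quot (BandAdj (cutBands c)) ⊕ Σ e : Edge, Fin (numCuts (c e) - 1)

/-- The closed curve through an arc. -/
def curveOf {L : TreeLabels} (c : L.CutPattern) (x : L.Arc) : Curve c :=
  let m := cutsBefore (c x.1.1) x.1.2
  if h : 0 < m ∧ m < numCuts (c x.1.1) then Sum.inr ⟨x.1.1, m - 1, by omega⟩
  else Sum.inl (Quot.mk _ (if m = 0 then (lowJoin x.1.1 x.2).1 else (highJoin x.1.1 x.2).1))

section

variable {L : TreeLabels} {c : L.CutPattern} {e : Edge} {i i' : Fin (L.len e + 1)}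

theorem curveOf_congr (h : cutsBefore (c e) i = cutsBefore (c e) i') (t : Bool) :
    curveOf c (⟨e, i⟩, t) = curveOf c (⟨e, i'⟩, t) := by
  simp only [curveOf, h]

theorem curveOf_between (h : 0 < cutsBefore (c e) i ∧ cutsBefore (c e) i < numCuts (c e))
    (t : Bool) :
    curveOf c (⟨e, i⟩, t) = Sum.inr ⟨e, cutsBefore (c e) i - 1, by omega⟩ :=
  dif_pos h

theorem curveOf_low (h : cutsBefore (c e) i = 0) (t : Bool) :
    curveOf c (⟨e, i⟩, t) = Sum.inl (Quot.mk _ (lowJoin e t).1) := by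
  simp [curveOf, h]

theorem curveOf_high (h : cutsBefore (c e) i = numCuts (c e)) (t : Bool) :
    curveOf c (⟨e, i⟩, t) = Sum.inl (Quot.mk _ (highJoin e t).1) := by
  by_cases h0 : numCuts (c e) = 0
  · rw [curveOf_low (h.trans h0)]
    exact congrArg _ (Quot.sound ⟨e, t, by simp [strand, cutBands, h0]⟩)
  · simp [curveOf, h, h0]

theorem curveOf_sides (h : 0 < numCuts (c e)) :
    curveOf c (⟨e, i⟩, true) = curveOf c (⟨e, i⟩, false) := by
  have hb : cutBands c e = true := by simp [cutBands, h]
  by_cases h0 : cutsBefore (c e) i = 0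
  · rw [curveOf_low h0, curveOf_low h0]
    exact congrArg _ (Quot.sound ⟨e, true, by simp [strand, hb]⟩)
  by_cases h1 : cutsBefore (c e) i = numCuts (c e)
  · rw [curveOf_high h1, curveOf_high h1]
    exact congrArg _ (Quot.sound ⟨e, false, by simp [strand, hb]⟩)
  · have hi : 0 < cutsBefore (c e) i ∧ cutsBefore (c e) i < numCuts (c e) :=
      ⟨Nat.pos_of_ne_zero h0, (cutsBefore_le _ _).lt_of_ne h1⟩
    rw [curveOf_between hi, curveOf_between hi]

end

section

variable {L : TreeLabels} (c : L.CutPattern)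

theorem curveOf_joinArc (m : Fin 4 × Fin 3) (k : Fin 2) :
    curveOf c (L.joinArc m k) = Sum.inl (Quot.mk _ m) := by
  obtain ⟨m, i⟩ := m
  have low (e : Edge) := curveOf_low (cutsBefore_zero (c e))
  have high (e : Edge) := curveOf_high (cutsBefore_last (c e))
  fin_cases m <;> fin_cases k <;> simp [joinArc, low, high, lowJoin, highJoin]

theorem curveOf_eq_of_arcAdj {x y : L.Arc} (h : ArcAdj c x y) : curveOf c x = curveOf c y := by
  rcases h with ⟨m, rfl, rfl⟩ | ⟨e, j, k, rfl, rfl⟩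
  · rw [curveOf_joinArc, curveOf_joinArc]
  cases hj : c e j
  · have up := curveOf_congr (c := c) (e := e) (i := j.castSucc) (i' := j.succ)
      (by rw [cutsBefore_succ, hj, Bool.toNat_false, Nat.add_zero])
    fin_cases k
    exacts [up true, up false, (up false).symm, (up true).symm]
  · have sides (i : Fin (L.len e + 1)) := curveOf_sides (i := i) (numCuts_pos hj)
    fin_cases k
    exacts [sides _, (sides _).symm, (sides _).symm, sides _]

theorem quotMk_joinArc_eq_of_bandAdj {x y : Fin 4 × Fin 3} (h : BandAdj (cutBands c) x y) :
    Quot.mk (ArcAdj c) (L.joinArc x 0) = Quot.mk _ (L.joinArc y 0) := by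
  obtain ⟨e, t, h⟩ := h
  obtain ⟨rfl, rfl⟩ := Prod.ext_iff.1 h
  by_cases hb : 0 < numCuts (c e)
  · cases t <;> simp only [strand, cutBands, hb, decide_true]
    · rw [quotMk_highJoin, quotMk_highJoin, quotMk_sides hb]
    · rw [quotMk_lowJoin, quotMk_lowJoin, quotMk_sides hb]
  · simp only [strand, cutBands, hb, decide_false]
    rw [quotMk_lowJoin, quotMk_highJoin]
    refine quotMk_level ?_ t
    rw [cutsBefore_zero, cutsBefore_last, Nat.eq_zero_of_not_pos hb]

theorem exists_level (x : Σ e : Edge, Fin (numCuts (c e) - 1)) :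
    ∃ i, cutsBefore (c x.1) i = x.2 + 1 :=
  let ⟨j, _, hj⟩ := exists_cut (c x.1) (m := x.2 + 1) (by omega)
  ⟨j.castSucc, hj⟩

/-- The class of arcs that lie on a closed curve. -/
noncomputable def arcsOn : Curve c → Quot (ArcAdj c) :=
  Sum.elim
    (Quot.lift (fun m => Quot.mk _ (L.joinArc m 0)) fun _ _ => quotMk_joinArc_eq_of_bandAdj c)
    fun x => Quot.mk _ (⟨x.1, (exists_level c x).choose⟩, true)

theorem arcsOn_curveOf (x : L.Arc) : arcsOn c (curveOf c x) = Quot.mk _ x := by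
  obtain ⟨⟨e, i⟩, t⟩ := x
  by_cases h0 : cutsBefore (c e) i = 0
  · rw [curveOf_low h0]
    exact (quotMk_lowJoin e t).trans (quotMk_level ((cutsBefore_zero _).trans h0.symm) t)
  by_cases h1 : cutsBefore (c e) i = numCuts (c e)
  · rw [curveOf_high h1]
    exact (quotMk_highJoin e t).trans (quotMk_level ((cutsBefore_last _).trans h1.symm) t)
  · have hi : 0 < cutsBefore (c e) i ∧ cutsBefore (c e) i < numCuts (c e) :=
      ⟨Nat.pos_of_ne_zero h0, (cutsBefore_le _ _).lt_of_ne h1⟩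
    rw [curveOf_between hi]
    refine (quotMk_level ?_ true).trans ?_ (b := Quot.mk _ (⟨e, i⟩, true))
    · rw [(exists_level c _).choose_spec, Nat.sub_add_cancel hi.1]
    · cases t
      exacts [quotMk_sides (hi.1.trans hi.2) i, rfl]

/-- The classes of arcs in a state are its closed curves. -/
noncomputable def curveEquiv : Quot (ArcAdj c) ≃ Curve c where
  toFun := Quot.lift (curveOf c) fun _ _ => curveOf_eq_of_arcAdj c
  invFun := arcsOn c
  left_inv := Quot.ind (arcsOn_curveOf c)
  right_inv := by
    rintro (x | x)
    · induction x using Quot.ind with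
      | mk m => exact curveOf_joinArc c m 0
    · have hx := (exists_level c x).choose_spec
      refine (curveOf_between (by omega) true).trans ?_
      simp only [hx, Nat.add_sub_cancel]

theorem card_quot_arcAdj :
    Nat.card (Quot (ArcAdj c)) =
      Nat.card (Quot (BandAdj (cutBands c))) + ∑ e, (numCuts (c e) - 1) := by
  rw [Nat.card_congr (curveEquiv c), Nat.card_sum, Nat.card_sigma]
  simp only [Nat.card_eq_fintype_card, Fintype.card_fin]

end

/-- The strands of all bands, as pairs of joins numbered by `finProdFinEquiv`. -/
def strandList (S : Edge → Bool) : List (Fin 12 × Fin 12) :=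
  ((List.finRange 3).flatMap fun i =>
    [strand S (Sum.inl i) false, strand S (Sum.inl i) true,
      strand S (Sum.inr i) false, strand S (Sum.inr i) true]).map
    (Prod.map finProdFinEquiv finProdFinEquiv)

theorem bandAdj_iff_mem_strandList {S : Edge → Bool} (x y : Fin 4 × Fin 3) :
    BandAdj S x y ↔ (finProdFinEquiv x, finProdFinEquiv y) ∈ strandList S := by
  have hinj : Function.Injective (finProdFinEquiv : Fin 4 × Fin 3 → Fin 12) :=
    finProdFinEquiv.injective
  change _ ↔ Prod.map finProdFinEquiv finProdFinEquiv (x, y) ∈ strandList S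
  rw [strandList, List.mem_map_of_injective (hinj.prodMap hinj)]
  simp only [BandAdj, Sum.exists, Bool.exists_bool, List.mem_flatMap, List.mem_finRange,
    List.mem_cons, List.not_mem_nil, or_false, true_and, ← exists_or, or_assoc,
    eq_comm (a := (x, y))]

/-- The set of cut bands that consists of the band `i` alone. -/
def onlyCut {ι : Type*} [DecidableEq ι] (i : ι) : ι → Bool := fun j => decide (j = i)

/-- One less than the number of closed curves when `i` inner and `j` outer bands are cut, unless
these are two bands opposite to each other.  A disk with three cut bands contains one closed
curve; the other curves of a disk match the six points on the circle as if two bands were cut. -/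
def baseLoops (i j : ℕ) : ℕ := Nat.dist (min i 2) (min j 2) + (i - 2) + (j - 2)

theorem card_quot_bandAdj (S T : Fin 3 → Bool) :
    Nat.card (Quot (BandAdj (Sum.elim S T))) =
      baseLoops (numCuts S) (numCuts T) +
        (if ∃ i, S = onlyCut i ∧ T = onlyCut (i + 1) then 2 else 0) + 1 := by
  rw [Nat.card_congr (Quot.congr (rb := fun a b => (a, b) ∈ strandList (Sum.elim S T))
    finProdFinEquiv bandAdj_iff_mem_strandList), card_quot_eq_card_image_classTable]
  revert S T
  decide +kernel

/-! ### State sums of six bands -/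

section StateSum

variable {R : Type*} [CommRing R]

/-- The product of the weights `f` when only the band `i` is cut. -/
def cutOnlyWeight {ι : Type*} [Fintype ι] [DecidableEq ι] (f : ι → Bool → R) (i : ι) : R :=
  ∏ j, f j (onlyCut i j)

/-- The pairing of an inner band with the opposite outer band. -/
def pairing (u v : Fin 3 → R) : R := ∑ i, u i * v (i + 1)

/-- The state sum of six bands with weights `f` and `g` and loop value `δ`, with the number of
closed curves replaced by `baseLoops`. -/
def baseStateSum (δ : R) (f g : Fin 3 → Bool → R) : R :=
  ∑ S : Fin 3 → Bool, ∑ T : Fin 3 → Bool,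
    (∏ i, f i (S i)) * (∏ i, g i (T i)) * δ ^ baseLoops (numCuts S) (numCuts T)

theorem baseStateSum_comp_perm (δ : R) (f g : Fin 3 → Bool → R) (τ : Equiv.Perm (Fin 3)) :
    baseStateSum δ f (g ∘ τ) = baseStateSum δ f g := by
  refine Finset.sum_congr rfl fun S _ =>
    Fintype.sum_equiv (τ.arrowCongr (Equiv.refl Bool)) _ _ fun T => ?_
  have weight : ∏ i, g i (T (τ.symm i)) = ∏ i, g (τ i) (T i) := by
    simpa using (Equiv.prod_comp τ fun i => g i (T (τ.symm i))).symm
  have cuts : numCuts (T ∘ τ.symm) = numCuts T := Equiv.sum_comp τ.symm fun i => (T i).toNat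
  change _ = _ * (∏ i, g i (T (τ.symm i))) * δ ^ baseLoops _ (numCuts (T ∘ τ.symm))
  rw [weight, cuts]
  rfl

theorem cutOnlyWeight_comp_perm {ι : Type*} [Fintype ι] [DecidableEq ι] (f : ι → Bool → R)
    (τ : Equiv.Perm ι) : cutOnlyWeight (f ∘ τ) = cutOnlyWeight f ∘ τ := by
  ext i
  simpa only [cutOnlyWeight, onlyCut, Function.comp_apply, τ.injective.eq_iff] using
    Equiv.prod_comp τ fun j => f j (onlyCut (τ i) j)

theorem numCuts_onlyCut {ι : Type*} [Fintype ι] [DecidableEq ι] (i : ι) :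
    numCuts (onlyCut i) = 1 := by
  simp [numCuts, onlyCut, Bool.toNat, Bool.cond_decide]

theorem onlyCut_injective {ι : Type*} [DecidableEq ι] :
    Function.Injective (onlyCut : ι → ι → Bool) := fun i j h => by
  simpa [onlyCut] using congrFun h i

theorem pow_card_quot_bandAdj (δ : R) (S T : Fin 3 → Bool) :
    δ ^ (Nat.card (Quot (BandAdj (Sum.elim S T))) - 1) =
      δ ^ baseLoops (numCuts S) (numCuts T) +
        (δ ^ 2 - 1) * ∑ i, if S = onlyCut i ∧ T = onlyCut (i + 1) then 1 else 0 := by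
  rw [card_quot_bandAdj, Nat.add_sub_cancel]
  by_cases h : ∃ i, S = onlyCut i ∧ T = onlyCut (i + 1)
  · obtain ⟨i, rfl, rfl⟩ := id h
    rw [if_pos h, numCuts_onlyCut, numCuts_onlyCut, Fintype.sum_eq_single i fun k hk =>
      if_neg fun hik => hk (onlyCut_injective hik.1).symm]
    simp [baseLoops]
  · rw [if_neg h, Finset.sum_eq_zero fun i _ => if_neg fun hi => h ⟨i, hi⟩]
    simp

theorem sum_bands_eq (δ : R) (f g : Fin 3 → Bool → R) :
    ∑ S : Edge → Bool, (∏ e, Sum.elim f g e (S e)) * δ ^ (Nat.card (Quot (BandAdj S)) - 1) =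
      baseStateSum δ f g + (δ ^ 2 - 1) * pairing (cutOnlyWeight f) (cutOnlyWeight g) := by
  have opposite (i : Fin 3) : cutOnlyWeight f i * cutOnlyWeight g (i + 1) =
      ∑ S : Fin 3 → Bool, ∑ T : Fin 3 → Bool, (∏ i, f i (S i)) * (∏ i, g i (T i)) *
        if S = onlyCut i ∧ T = onlyCut (i + 1) then 1 else 0 := by
    simp [cutOnlyWeight, ite_and]
  have split : ∑ S : Edge → Bool,
      (∏ e, Sum.elim f g e (S e)) * δ ^ (Nat.card (Quot (BandAdj S)) - 1) =
      ∑ S : Fin 3 → Bool, ∑ T : Fin 3 → Bool, (∏ i, f i (S i)) * (∏ i, g i (T i)) *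
        δ ^ (Nat.card (Quot (BandAdj (Sum.elim S T))) - 1) := by
    rw [← (Equiv.sumArrowEquivProdArrow (Fin 3) (Fin 3) Bool).symm.sum_comp,
      Fintype.sum_prod_type]
    simp only [Fintype.prod_sum_type]
    rfl
  rw [split, pairing, Finset.sum_congr rfl fun i _ => opposite i, baseStateSum]
  simp only [pow_card_quot_bandAdj, mul_add, Finset.sum_add_distrib]
  congr 1
  conv_rhs => rw [Finset.sum_comm, Finset.mul_sum]
  refine Finset.sum_congr rfl fun S _ => ?_
  conv_rhs => rw [Finset.sum_comm, Finset.mul_sum]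
  refine Finset.sum_congr rfl fun T _ => ?_
  rw [← Finset.mul_sum, mul_left_comm]

theorem pairing_comp_swap_eq_iff [NoZeroDivisors R] (u v : Fin 3 → R) (j : Fin 3) :
    pairing u v = pairing u (v ∘ Equiv.swap j (j + 1)) ↔ u j = u (j + 2) ∨ v j = v (j + 1) := by
  have sub_eq : pairing u v - pairing u (v ∘ Equiv.swap j (j + 1)) =
      (u j - u (j + 2)) * (v (j + 1) - v j) := by
    simp only [pairing, Fin.sum_univ_three]
    fin_cases j
    · change u 0 * v 1 + u 1 * v 2 + u 2 * v 0 - (u 0 * v 0 + u 1 * v 2 + u 2 * v 1) =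
        (u 0 - u 2) * (v 1 - v 0)
      ring
    · change u 0 * v 1 + u 1 * v 2 + u 2 * v 0 - (u 0 * v 2 + u 1 * v 1 + u 2 * v 0) =
        (u 1 - u 0) * (v 2 - v 1)
      ring
    · change u 0 * v 1 + u 1 * v 2 + u 2 * v 0 - (u 0 * v 1 + u 1 * v 0 + u 2 * v 2) =
        (u 2 - u 1) * (v 0 - v 2)
      ring
  rw [← sub_eq_zero, sub_eq, mul_eq_zero, sub_eq_zero, sub_eq_zero, eq_comm (a := v j)]

theorem cutOnlyWeight_eq_iff [IsDomain R] {ι : Type*} [Fintype ι] [DecidableEq ι]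
    {f : ι → Bool → R} (hf : ∀ j, f j false ≠ 0) (i k : ι) :
    cutOnlyWeight f i = cutOnlyWeight f k ↔ f i true * f k false = f k true * f i false := by
  have mul_uncut (i : ι) : cutOnlyWeight f i * f i false = f i true * ∏ j, f j false := by
    rw [cutOnlyWeight, Fintype.prod_eq_mul_prod_compl i, Fintype.prod_eq_mul_prod_compl i,
      Finset.prod_congr rfl fun j hj => by rw [onlyCut, decide_eq_false (by simpa using hj)]]
    simp only [onlyCut, decide_true]
    ring
  have uncut_ne_zero : ∏ j, f j false ≠ 0 := Finset.prod_ne_zero_iff.2 fun j _ => hf j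
  calc
    cutOnlyWeight f i = cutOnlyWeight f k
      ↔ cutOnlyWeight f i * (f i false * f k false) =
          cutOnlyWeight f k * (f i false * f k false) :=
        (mul_left_inj' (mul_ne_zero (hf i) (hf k))).symm
    _ ↔ f i true * f k false * ∏ j, f j false = f k true * f i false * ∏ j, f j false := by
        rw [← mul_assoc, mul_uncut i, mul_comm (f i false), ← mul_assoc, mul_uncut k,
          mul_right_comm, mul_right_comm (f k true)]
    _ ↔ _ := mul_left_inj' uncut_ne_zero

end StateSum

open LaurentPolynomial (T)

/-! ### The Kauffman bracket -/

/-- The value of a closed curve in the Kauffman bracket. -/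
noncomputable def loopValue : ℤ[T;T⁻¹] := -T 2 - T (-2)

/-- The contribution to the Kauffman bracket of a band with label `n` whose crossings `j` with
`b j = true` cut it.  It includes the closed curves between consecutive cuts. -/
noncomputable def bandStateWeight (n : ℤ) (b : Fin n.natAbs → Bool) : ℤ[T;T⁻¹] :=
  (∏ j, T (n.sign * if b j then 1 else -1)) * loopValue ^ (numCuts b - 1)

/-- The contribution to the Kauffman bracket of a band with label `n` from all states that cut it,
or from those that leave it uncut. -/
noncomputable def bandWeight (n : ℤ) (cut : Bool) : ℤ[T;T⁻¹] :=
  ∑ b : Fin n.natAbs → Bool with decide (0 < numCuts b) = cut, bandStateWeight n b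

theorem T_sum {ι : Type*} (s : Finset ι) (f : ι → ℤ) :
    (T (∑ i ∈ s, f i) : ℤ[T;T⁻¹]) = ∏ i ∈ s, T (f i) := by
  classical
  induction s using Finset.induction_on with
  | empty => simp
  | insert i s hi ih =>
    rw [Finset.sum_insert hi, Finset.prod_insert hi, LaurentPolynomial.T_add, ih]

theorem card_quot_bandAdj_pos (S : Edge → Bool) : 0 < Nat.card (Quot (BandAdj S)) :=
  Nat.card_pos_iff.2 ⟨⟨Quot.mk _ (0, 0)⟩, inferInstance⟩

theorem bracket_term_eq {L : TreeLabels} (s : L.diagram.Crossing → Bool) :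
    T (∑ x, if s x then 1 else -1) * (-T 2 - T (-2)) ^ (L.diagram.loops s - 1) =
      (∏ e, bandStateWeight (L.twist e) (L.cutPattern s e)) *
        loopValue ^ (Nat.card (Quot (BandAdj (cutBands (L.cutPattern s)))) - 1) := by
  have exponent (e : Edge) (j : Fin (L.len e)) : (if s ⟨e, j⟩ then 1 else -1 : ℤ) =
      (L.twist e).sign * if L.cutPattern s e j then 1 else -1 := by
    change _ = _ * if s ⟨e, j⟩ == decide (0 < L.twist e) then 1 else -1
    rcases lt_trichotomy (L.twist e) 0 with ht | ht | ht
    · cases s ⟨e, j⟩ <;> simp [ht.not_gt, Int.sign_eq_neg_one_of_neg ht]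
    · exact absurd j.2 (by simp [len, ht])
    · cases s ⟨e, j⟩ <;> simp [ht, Int.sign_eq_one_of_pos ht]
  have crossings : (T (∑ x, if s x then 1 else -1) : ℤ[T;T⁻¹]) =
      ∏ e, ∏ j, T ((L.twist e).sign * if L.cutPattern s e j then 1 else -1) := by
    rw [T_sum]
    refine (Fintype.prod_sigma _).trans ?_
    exact Finset.prod_congr rfl fun e _ => Finset.prod_congr rfl fun j _ =>
      congrArg T (exponent e j)
  rw [crossings, loops_eq_card_quot_arcAdj, card_quot_arcAdj,
    Nat.sub_add_comm (card_quot_bandAdj_pos _), pow_add, ← Finset.prod_pow_eq_pow_sum, ← loopValue]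
  simp only [bandStateWeight, Finset.prod_mul_distrib]
  exact (mul_left_comm _ _ _).trans (mul_comm _ _)

theorem bracket_eq_sum_bands (L : TreeLabels) :
    L.diagram.bracket = ∑ S : Edge → Bool, (∏ e, bandWeight (L.twist e) (S e)) *
      loopValue ^ (Nat.card (Quot (BandAdj S)) - 1) := by
  have expand (S : Edge → Bool) : ∏ e, bandWeight (L.twist e) (S e) =
      ∑ c : L.CutPattern with cutBands c = S, ∏ e, bandStateWeight (L.twist e) (c e) := by
    refine (Finset.prod_univ_sum _ _).trans (Finset.sum_congr ?_ fun _ _ => rfl)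
    ext c
    refine Fintype.mem_piFinset.trans ?_
    refine .trans ?_ (Finset.mem_filter_univ (α := L.CutPattern) c).symm
    exact (forall_congr' fun e => Finset.mem_filter_univ (c e)).trans funext_iff.symm
  calc L.diagram.bracket
    _ = ∑ s : L.diagram.Crossing → Bool, (∏ e, bandStateWeight (L.twist e) (L.cutPattern s e)) *
          loopValue ^ (Nat.card (Quot (BandAdj (cutBands (L.cutPattern s)))) - 1) :=
      Finset.sum_congr rfl fun s _ => bracket_term_eq s
    _ = ∑ c : L.CutPattern, (∏ e, bandStateWeight (L.twist e) (c e)) *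
          loopValue ^ (Nat.card (Quot (BandAdj (cutBands c))) - 1) :=
      L.cutPattern.sum_comp fun c => (∏ e, bandStateWeight (L.twist e) (c e)) *
        loopValue ^ (Nat.card (Quot (BandAdj (cutBands c))) - 1)
    _ = ∑ S, ∑ c : L.CutPattern with cutBands c = S, (∏ e, bandStateWeight (L.twist e) (c e)) *
          loopValue ^ (Nat.card (Quot (BandAdj (cutBands c))) - 1) :=
      (Finset.sum_fiberwise _ _ _).symm
    _ = _ := Finset.sum_congr rfl fun S _ => by
      rw [expand, Finset.sum_mul]
      exact Finset.sum_congr rfl fun c hc => by rw [(Finset.mem_filter.1 hc).2]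

theorem numCuts_eq_zero_iff {ι : Type*} [Fintype ι] {b : ι → Bool} :
    numCuts b = 0 ↔ b = fun _ => false := by
  simp [numCuts, funext_iff]

theorem bandWeight_false (n : ℤ) : bandWeight n false = T (-n) := by
  have filter_eq : (Finset.univ.filter fun b : Fin n.natAbs → Bool =>
      decide (0 < numCuts b) = false) = {fun _ => false} := by
    ext b
    rw [Finset.mem_filter_univ, decide_eq_false_iff_not, Nat.not_lt, Nat.le_zero,
      numCuts_eq_zero_iff, Finset.mem_singleton]
  rw [bandWeight, filter_eq, Finset.sum_singleton, bandStateWeight, ← T_sum]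
  simp [numCuts, mul_comm |n|, Int.sign_mul_abs]

theorem loopValue_mul_bandWeight_true_add (n : ℤ) :
    loopValue * bandWeight n true + bandWeight n false =
      (T n.sign * loopValue + T (-n.sign)) ^ n.natAbs := by
  have cut {b : Fin n.natAbs → Bool} (hb : decide (0 < numCuts b) = true) :
      loopValue * bandStateWeight n b =
        ∏ j, T (n.sign * if b j then 1 else -1) * loopValue ^ (b j).toNat := by
    rw [bandStateWeight, mul_left_comm, mul_pow_sub_one (of_decide_eq_true hb).ne', numCuts,
      Finset.prod_mul_distrib, Finset.prod_pow_eq_pow_sum]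
  have uncut {b : Fin n.natAbs → Bool} (hb : decide (0 < numCuts b) = false) :
      bandStateWeight n b =
        ∏ j, T (n.sign * if b j then 1 else -1) * loopValue ^ (b j).toNat := by
    have h0 : numCuts b = 0 := Nat.eq_zero_of_not_pos (of_decide_eq_false hb)
    rw [bandStateWeight, h0, Finset.prod_mul_distrib, Finset.prod_pow_eq_pow_sum, ← numCuts, h0]
  calc loopValue * bandWeight n true + bandWeight n false
    _ = ∑ b : Fin n.natAbs → Bool, ∏ j, T (n.sign * if b j then 1 else -1) *
          loopValue ^ (b j).toNat := by
      rw [← Finset.sum_fiberwise _ fun b => decide (0 < numCuts b), Fintype.sum_bool,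
        bandWeight, Finset.mul_sum, bandWeight]
      exact congrArg₂ _ (Finset.sum_congr rfl fun b hb => cut (Finset.mem_filter.1 hb).2)
        (Finset.sum_congr rfl fun b hb => uncut (Finset.mem_filter.1 hb).2)
    _ = ∏ _j : Fin n.natAbs, ∑ t : Bool, T (n.sign * if t then 1 else -1) *
          loopValue ^ t.toNat := by
      rw [Finset.prod_univ_sum, Fintype.piFinset_univ]
    _ = _ := by simp

theorem T_mul_loopValue_add {ε : ℤ} (hε : ε = 1 ∨ ε = -1) :
    T ε * loopValue + T (-ε) = -T (3 * ε) := by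
  rw [loopValue, mul_sub, mul_neg, ← LaurentPolynomial.T_add, ← LaurentPolynomial.T_add]
  rcases hε with rfl | rfl
  · change (-T 3 - T (-1) + T (-1) : ℤ[T;T⁻¹]) = -T 3
    ring
  · change (-T 1 - T (-3) + T 1 : ℤ[T;T⁻¹]) = -T (-3)
    ring

theorem loopValue_mul_bandWeight_true (n : ℤ) :
    loopValue * bandWeight n true =
      LaurentPolynomial.C ((-1) ^ n.natAbs) * T (3 * n) - T (-n) := by
  rw [eq_sub_iff_add_eq, ← bandWeight_false, loopValue_mul_bandWeight_true_add]
  rcases eq_or_ne n 0 with rfl | hn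
  · simp
  have hsign : n.sign = 1 ∨ n.sign = -1 :=
    hn.gt_or_lt.imp Int.sign_eq_one_of_pos Int.sign_eq_neg_one_of_neg
  rw [T_mul_loopValue_add hsign, neg_pow, LaurentPolynomial.T_pow, mul_left_comm, mul_comm _ n.sign,
    Int.sign_mul_natAbs]
  simp

theorem bandWeight_mul_eq_iff (m n : ℤ) :
    bandWeight m true * bandWeight n false = bandWeight n true * bandWeight m false ↔ m = n := by
  refine ⟨fun h => ?_, fun h => by rw [h]⟩
  rw [bandWeight_false, bandWeight_false] at h
  have top : LaurentPolynomial.C ((-1) ^ m.natAbs) * T (3 * m - n) =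
      LaurentPolynomial.C ((-1) ^ n.natAbs) * T (3 * n - m) := by
    simp only [sub_eq_add_neg, LaurentPolynomial.T_add]
    linear_combination loopValue * h - loopValue_mul_bandWeight_true m * T (-n) +
      loopValue_mul_bandWeight_true n * T (-m)
  have degree (k : ℕ) (l : ℤ) :
      (LaurentPolynomial.C ((-1) ^ k) * T l : ℤ[T;T⁻¹]).degree = l :=
    LaurentPolynomial.degree_C_mul_T l _ (pow_ne_zero k (by decide))
  have degree_eq := congrArg LaurentPolynomial.degree top
  rw [degree, degree, WithBot.coe_inj] at degree_eq
  omega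

theorem loopValue_sq_sub_one_ne_zero : loopValue ^ 2 - 1 ≠ 0 := by
  have expand : loopValue ^ 2 - 1 = T 4 + T (-4) + T 0 := by
    have hinv : (T 2 * T (-2) : ℤ[T;T⁻¹]) = 1 := by rw [← LaurentPolynomial.T_add]; simp
    have hsq : (T 2 ^ 2 : ℤ[T;T⁻¹]) = T 4 := LaurentPolynomial.T_pow 2 2
    have hsq' : (T (-2) ^ 2 : ℤ[T;T⁻¹]) = T (-4) := LaurentPolynomial.T_pow (-2) 2
    rw [loopValue, LaurentPolynomial.T_zero]
    linear_combination 2 * hinv + hsq + hsq'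
  intro h
  have coeff_four := congrArg (fun f : ℤ[T;T⁻¹] => f.coeff 4) (expand.symm.trans h)
  simp [-LaurentPolynomial.T_zero] at coeff_four

/-! ### Transpositions of the outer labels -/

/-- The labels of the inner tree. -/
def inner (L : TreeLabels) : Fin 3 → ℤ := ![L.p, L.q, L.r]

/-- The labels of the outer tree. -/
def outer (L : TreeLabels) : Fin 3 → ℤ := ![L.a, L.b, L.c]

/-- The labels with the three positions of the outer tree permuted by `τ`. -/
def permuteOuter (L : TreeLabels) (τ : Equiv.Perm (Fin 3)) : TreeLabels :=
  ⟨L.p, L.q, L.r, L.outer (τ 0), L.outer (τ 1), L.outer (τ 2)⟩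

theorem inner_permuteOuter (L : TreeLabels) (τ : Equiv.Perm (Fin 3)) :
    (L.permuteOuter τ).inner = L.inner := rfl

theorem outer_permuteOuter (L : TreeLabels) (τ : Equiv.Perm (Fin 3)) :
    (L.permuteOuter τ).outer = L.outer ∘ τ := by
  ext i
  fin_cases i <;> rfl

theorem bracket_eq_add_pairing (L : TreeLabels) :
    L.diagram.bracket = baseStateSum loopValue (bandWeight ∘ L.inner) (bandWeight ∘ L.outer) +
      (loopValue ^ 2 - 1) * pairing (cutOnlyWeight (bandWeight ∘ L.inner))
        (cutOnlyWeight (bandWeight ∘ L.outer)) := by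
  rw [bracket_eq_sum_bands, ← sum_bands_eq, ← Sum.comp_elim]
  rfl

theorem cutOnlyWeight_bandWeight_eq_iff {ι : Type*} [Fintype ι] [DecidableEq ι] (n : ι → ℤ)
    (i k : ι) :
    cutOnlyWeight (bandWeight ∘ n) i = cutOnlyWeight (bandWeight ∘ n) k ↔ n i = n k := by
  have uncut_ne_zero (j : ι) : (bandWeight ∘ n) j false ≠ 0 := by
    rw [Function.comp_apply, bandWeight_false]
    exact (LaurentPolynomial.isUnit_T _).ne_zero
  exact (cutOnlyWeight_eq_iff uncut_ne_zero i k).trans (bandWeight_mul_eq_iff _ _)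

theorem bracket_eq_iff (L : TreeLabels) (j : Fin 3) :
    L.diagram.bracket = (L.permuteOuter (Equiv.swap j (j + 1))).diagram.bracket ↔
      L.inner j = L.inner (j + 2) ∨ L.outer j = L.outer (j + 1) := by
  rw [bracket_eq_add_pairing, bracket_eq_add_pairing, inner_permuteOuter, outer_permuteOuter,
    ← Function.comp_assoc, baseStateSum_comp_perm, cutOnlyWeight_comp_perm, add_right_inj,
    mul_right_inj' loopValue_sq_sub_one_ne_zero]
  exact (pairing_comp_swap_eq_iff _ _ j).trans <|
    or_congr (cutOnlyWeight_bandWeight_eq_iff _ _ _) (cutOnlyWeight_bandWeight_eq_iff _ _ _)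

theorem EqByD3.pairing_eq {L L' : TreeLabels} (h : EqByD3 L L') :
    pairing L.inner L.outer = pairing L'.inner L'.outer := by
  induction h with
  | rel _ _ h =>
    simp only [pairing, Fin.sum_univ_three]
    cases h with
    | rotation p q r a b c =>
      change p * b + q * c + r * a = q * c + r * a + p * b
      ring
    | reflection p q r a b c =>
      change p * b + q * c + r * a = p * b + r * a + q * c
      ring
  | refl => rfl
  | symm _ _ _ ih => exact ih.symm
  | trans _ _ _ _ _ ih ih' => exact ih.trans ih'

theorem eqByD3_reflect (p q r a b c : ℤ) : EqByD3 ⟨p, q, r, a, b, c⟩ ⟨p, r, q, c, b, a⟩ :=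
  .rel _ _ (.reflection p q r a b c)

theorem eqByD3_reflect_rotate (p q r a b c : ℤ) : EqByD3 ⟨p, q, r, a, b, c⟩ ⟨r, q, p, b, a, c⟩ :=
  (eqByD3_reflect p q r a b c).trans _ _ _ (.rel _ _ (.rotation p r q c b a))

theorem eqByD3_reflect_rotate_rotate (p q r a b c : ℤ) :
    EqByD3 ⟨p, q, r, a, b, c⟩ ⟨q, p, r, a, c, b⟩ :=
  (eqByD3_reflect_rotate p q r a b c).trans _ _ _ (.rel _ _ (.rotation r q p b a c))

theorem eqByD3_permuteOuter_iff (L : TreeLabels) (j : Fin 3) :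
    EqByD3 L (L.permuteOuter (Equiv.swap j (j + 1))) ↔
      L.inner j = L.inner (j + 2) ∨ L.outer j = L.outer (j + 1) := by
  constructor
  · intro h
    rw [← pairing_comp_swap_eq_iff, ← outer_permuteOuter]
    exact h.pairing_eq
  · obtain ⟨p, q, r, a, b, c⟩ := L
    rintro (h | h)
    · fin_cases j
      · obtain rfl : p = r := h
        exact eqByD3_reflect_rotate p q p a b c
      · obtain rfl : q = p := h
        exact eqByD3_reflect_rotate_rotate q q r a b c
      · obtain rfl : r = q := h
        exact eqByD3_reflect p r r a b c
    · have permute_eq : permuteOuter ⟨p, q, r, a, b, c⟩ (Equiv.swap j (j + 1)) =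
          ⟨p, q, r, a, b, c⟩ := by
        fin_cases j <;> simp_all [permuteOuter, outer, Equiv.swap_apply_def]
      rw [permute_eq]
      exact .refl _

theorem exists_eq_swap_add_one {τ : Equiv.Perm (Fin 3)} (hτ : τ.IsSwap) :
    ∃ j, τ = Equiv.swap j (j + 1) := by
  obtain ⟨x, y, hxy, rfl⟩ := hτ
  revert x y
  decide

theorem bracket_eq_iff_eqByD3 (L : TreeLabels) {τ : Equiv.Perm (Fin 3)} (hτ : τ.IsSwap) :
    L.diagram.bracket = (L.permuteOuter τ).diagram.bracket ↔ EqByD3 L (L.permuteOuter τ) := by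
  obtain ⟨j, rfl⟩ := exists_eq_swap_add_one hτ
  rw [bracket_eq_iff, eqByD3_permuteOuter_iff]

theorem twist_permuteOuter (L : TreeLabels) (τ : Equiv.Perm (Fin 3)) :
    (L.permuteOuter τ).twist = L.twist ∘ Equiv.sumCongr (Equiv.refl _) τ := by
  ext (i | i) <;> fin_cases i <;> rfl

theorem writhe_permuteOuter {L : TreeLabels} {τ : Equiv.Perm (Fin 3)}
    (heven : ∀ e, Even (L.twist e)) (o : L.diagram.Orientation)
    (o' : (L.permuteOuter τ).diagram.Orientation) :
    L.diagram.writhe o = (L.permuteOuter τ).diagram.writhe o' := by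
  have heven' (e : Edge) : Even ((L.permuteOuter τ).twist e) := by
    rw [twist_permuteOuter]
    exact heven _
  rw [writhe_eq_sum_twist o heven, writhe_eq_sum_twist o' heven', twist_permuteOuter]
  exact (Equiv.sum_comp _ L.twist).symm

end TreeLabels

theorem LinkDiagram.jones_eq_iff_bracket_eq {D D' : LinkDiagram} {o : D.Orientation}
    {o' : D'.Orientation} (h : D.writhe o = D'.writhe o') :
    D.jones o = D'.jones o' ↔ D.bracket = D'.bracket := by
  rw [LinkDiagram.jones, LinkDiagram.jones, h, LaurentPolynomial.invert.injective.eq_iff]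
  refine IsUnit.mul_right_inj (IsUnit.mul ?_ (LaurentPolynomial.isUnit_T _))
  exact (Units.isUnit _).map LaurentPolynomial.C

theorem lemma4p7_general (L : TreeLabels) (τ : Equiv.Perm (Fin 3)) (hτ : τ.IsSwap)
    (o : L.diagram.Orientation) (o' : (L.permuteOuter τ).diagram.Orientation)
    (hw : L.diagram.writhe o = (L.permuteOuter τ).diagram.writhe o') :
    L.diagram.jones o = (L.permuteOuter τ).diagram.jones o' ↔
      TreeLabels.EqByD3 L (L.permuteOuter τ) :=
  (LinkDiagram.jones_eq_iff_bracket_eq hw).trans (L.bracket_eq_iff_eqByD3 hτ)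

theorem lemma4p7 (p q r a b c : ℤ) (hp : Even p) (hq : Even q) (hr : Even r)
    (ha : Even a) (hb : Even b) (hc : Even c) (τ : Equiv.Perm (Fin 3)) (hτ : τ.IsSwap)
    (o : (TreeLabels.mk p q r a b c).diagram.Orientation)
    (o' : (TreeLabels.mk p q r
      (![a, b, c] (τ 0)) (![a, b, c] (τ 1)) (![a, b, c] (τ 2))).diagram.Orientation) :
    (TreeLabels.mk p q r a b c).diagram.jones o =
        (TreeLabels.mk p q r
          (![a, b, c] (τ 0)) (![a, b, c] (τ 1)) (![a, b, c] (τ 2))).diagram.jones o' ↔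
      TreeLabels.EqByD3 (TreeLabels.mk p q r a b c)
        (TreeLabels.mk p q r (![a, b, c] (τ 0)) (![a, b, c] (τ 1)) (![a, b, c] (τ 2))) :=
  lemma4p7_general ⟨p, q, r, a, b, c⟩ τ hτ o o' <|
    TreeLabels.writhe_permuteOuter (by rintro (i | i) <;> fin_cases i <;> assumption) o o'
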